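/- Let $d,n\ge 2$ be integers and $\varepsilon>0$. Let $R=(\rho_1,\ldots,\rho_d)$ be a $d$-tuple of positive definite Hermitian $n\times n$ complex matrices with $\operatorname{tr}\rho_1=\cdots=\operatorname{tr}\rho_d$, and let $C$ be a Hermitian matrix acting on $(\mathbb{C}^n)^{\otimes d}$. Let $\Gamma_o(R)$ be the set of positive definite matrices $\rho$ on $(\mathbb{C}^n)^{\otimes d}$ such that, for every $j$, the partial trace of $\rho$ over all tensor factors except the $j$-th equals $\rho_j$, and put $$\kappa_\beta(C,R,\varepsilon)=\inf_{\rho\in\Gamma_o(R)}\bigl(\operatorname{tr}C\rho-\varepsilon\log\det\rho\bigr).$$ For Hermitian $n\times n$ matrices $X_1,\ldots,X_d$ let $$C(X_1,\ldots,X_d)=C-\sum_{j=1}^d I^{\otimes(j-1)}\otimes X_j\otimes I^{\otimes(d-j)},$$ let $\hat{\mathrm D}$ be the set of $d$-tuples $(X_1,\ldots,X_d)$ of Hermitian $n\times n$ matrices for which $C(X_1,\ldots,X_d)$ is positive definite, let $\mathrm D=\{(X_1,\ldots,X_d)\in\hat{\mathrm D}:\operatorname{tr}X_1=\cdots=\operatorname{tr}X_d\}$,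 and define on $\hat{\mathrm D}$ $$\varphi(X_1,\ldots,X_d)=\sum_{j=1}^d\operatorname{tr}\rho_jX_j+\varepsilon\log\det C(X_1,\ldots,X_d)+n^d\varepsilon(1-\log\varepsilon).$$ Then $\varphi$ is concave on $\hat{\mathrm D}$ and strictly concave on $\mathrm D$. The infimum $\kappa_\beta(C,R,\varepsilon)$ is attained, the maxima of $\varphi$ over $\hat{\mathrm D}$ and over $\mathrm D$ exist, and $$\max_{\hat{\mathrm D}}\varphi=\max_{\mathrm D}\varphi=\kappa_\beta(C,R,\varepsilon).$$ Moreover, there is a $d$-tuple $(U_1,\ldots,U_d)$ such that the set of maximizers of $\varphi$ in $\hat{\mathrm D}$ is exactly the affine set $$\mathrm L=\Bigl\{(U_1+t_1I,\ldots,U_d+t_dI): t_1,\ldots,t_d\in\mathbb{R},\ \sum_{j=1}^dt_j=0\Bigr\},$$ $\mathrm L$ meets $\mathrm D$ in the single point $(U_1,\ldots,U_d)$, and for every $(X_1,\ldots,X_d)\in\mathrm L$ the matrix $\rho^\star=\varepsilon\,C(X_1,\ldots,X_d)^{-1}$ is the unique point of $\Gamma_o(R)$ at which $\kappa_\beta(C,R,\varepsilon)$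 is attained. -/

import Mathlib

open scoped ComplexOrder

noncomputable section

namespace QOT

/-- `n × n` complex matrices. -/
abbrev Mat (n : ℕ) : Type := Matrix (Fin n) (Fin n) ℂ

/-- Complex matrices acting on the `d`-fold tensor power of `ℂⁿ`; rows and columns are indexed by
multi-indices `(i₁, …, i_d)`. -/
abbrev MultiMat (d n : ℕ) : Type := Matrix (Fin d → Fin n) (Fin d → Fin n) ℂ

/-- The tensor (Kronecker) product `A₁ ⊗ ⋯ ⊗ A_d`. -/
def tensor {d n : ℕ} (A : Fin d → Mat n) : MultiMat d n :=
  Matrix.of fun a b => ∏ k, A k (a k) (b k)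

/-- `I ⊗ ⋯ ⊗ I ⊗ X ⊗ I ⊗ ⋯ ⊗ I` with `X` in the `j`-th place. -/
def lift {d n : ℕ} (j : Fin d) (X : Mat n) : MultiMat d n :=
  tensor (Function.update (fun _ => (1 : Mat n)) j X)

/-- The partial trace of `ρ` over all tensor factors except the `j`-th: its `(p, q)` entry is the
sum of `ρ a b` over all multi-indices `a`, `b` with `a j = p`, `b j = q` which agree elsewhere. -/
def marginal {d n : ℕ} (j : Fin d) (ρ : MultiMat d n) : Mat n :=
  Matrix.of fun p q => ∑ a : Fin d → Fin n with a j = p, ρ a (Function.update a j q)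

/-- `d`-tuples of positive definite matrices with equal traces. -/
def balanced (d n : ℕ) : Set (Fin d → Mat n) :=
  {R | (∀ j, (R j).PosDef) ∧ ∀ i j, (R i).trace = (R j).trace}

/-- The coupling set `Γ(R)`: positive semidefinite matrices with marginals `R`. -/
def coupling {d n : ℕ} (R : Fin d → Mat n) : Set (MultiMat d n) :=
  {ρ | ρ.PosSemidef ∧ ∀ j, marginal j ρ = R j}

/-- The positive definite couplings `Γ_o(R)`. -/
def couplingInt {d n : ℕ} (R : Fin d → Mat n) : Set (MultiMat d n) :=
  coupling R ∩ {ρ | ρ.PosDef}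

/-- The barrier `β(H) = -log det H` (the determinant is a positive real for positive definite
`H`). -/
def barrier {ι : Type*} [Fintype ι] [DecidableEq ι] (H : Matrix ι ι ℂ) : ℝ :=
  -Real.log H.det.re

/-- The relaxed primal objective `tr Cρ + ε β(ρ)` (the trace is real for Hermitian `C`, `ρ`). -/
def objective {d n : ℕ} (C : MultiMat d n) (ε : ℝ) (ρ : MultiMat d n) : ℝ :=
  (C * ρ).trace.re + ε * barrier ρ

/-- The value `κ_β(C, R, ε)` of the relaxed primal problem over `Γ_o(R)`. -/
def kappaBeta {d n : ℕ} (C : MultiMat d n) (R : Fin d → Mat n) (ε : ℝ) : ℝ :=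
  sInf (objective C ε '' couplingInt R)

/-- `C(X₁, …, X_d) = C - ∑ⱼ I ⊗ ⋯ ⊗ Xⱼ ⊗ ⋯ ⊗ I`. -/
def slack {d n : ℕ} (C : MultiMat d n) (X : Fin d → Mat n) : MultiMat d n :=
  C - ∑ j, lift j (X j)

/-- The domain `D̂`: tuples of Hermitian matrices with `C(X₁, …, X_d)` positive definite. -/
def domainHat {d n : ℕ} (C : MultiMat d n) : Set (Fin d → Mat n) :=
  {X | (∀ j, (X j).IsHermitian) ∧ (slack C X).PosDef}

/-- The slice `D` of `D̂` given by `tr X₁ = ⋯ = tr X_d`. -/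
def domain {d n : ℕ} (C : MultiMat d n) : Set (Fin d → Mat n) :=
  {X | X ∈ domainHat C ∧ ∀ i j, (X i).trace = (X j).trace}

/-- The dual function
`φ(X) = ∑ⱼ tr ρⱼXⱼ - ε β(C(X₁, …, X_d)) + nᵈ ε (1 - log ε)`. -/
def dual {d n : ℕ} (C : MultiMat d n) (R : Fin d → Mat n) (ε : ℝ) (X : Fin d → Mat n) : ℝ :=
  ∑ j, (R j * X j).trace.re - ε * barrier (slack C X) + (n : ℝ) ^ d * ε * (1 - Real.log ε)

/-- The affine set `(U₁, …, U_d) + {(t₁ I, …, t_d I) : t ∈ ℝᵈ, ∑ⱼ tⱼ = 0}`. -/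
def shifts {d n : ℕ} (U : Fin d → Mat n) : Set (Fin d → Mat n) :=
  {X | ∃ t : Fin d → ℝ, ∑ j, t j = 0 ∧ ∀ j, X j = U j + t j • (1 : Mat n)}

end QOT

end

/-! The engine is one inequality: for positive definite `A`, `B` of size `N`, `tr AB - log det A -
log det B ≥ N`, with equality only for `B = A⁻¹`. Conjugation by a factor of `A` reduces it to `λ -
1 ≥ log λ` on eigenvalues. Taking `A = C(X)` and `B = ρ/ε`, its defect times `ε` is exactly the
duality gap (`objective_sub_dual`), so the gap vanishes iff `ρ = ε C(X)⁻¹`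
(`dual_eq_objective_iff`). A single pair with zero gap therefore yields both optimal values and
uniqueness of `ρ` and of `C(X)`.

Such a pair comes from the primal side. Couplings form a compact set and the barrier keeps a
minimizer `ρ` positive definite (`exists_isMinOn_objective`). Stationarity along directions with
zero marginals forces `C - ε ρ⁻¹` to be a sum of one-factor terms (`exists_slack_eq_of_isMinOn`).
The remaining freedom in `X` is the kernel of `liftSum`, namely scalars with sum zero; equal traces
remove it. -/

namespace QOT

/-! ### The barrier and the trace-determinant inequality. -/

section Matrices

variable {ι : Type*} [Fintype ι] [DecidableEq ι]

theorem exists_isUnit_conjTranspose_mul_self {A : Matrix ι ι ℂ} (hA : A.PosDef) :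
    ∃ M : Matrix ι ι ℂ, IsUnit M ∧ A = M.conjTranspose * M := by
  open scoped MatrixOrder in
  obtain ⟨M, hM⟩ := CStarAlgebra.nonneg_iff_eq_star_mul_self.mp hA.posSemidef.nonneg
  refine ⟨M, ?_, hM⟩
  have h := hA.isUnit
  rw [hM] at h
  rw [Matrix.isUnit_iff_isUnit_det] at h ⊢
  rw [Matrix.det_mul] at h
  exact isUnit_of_mul_isUnit_right h

theorem det_im_eq_zero {A : Matrix ι ι ℂ} (hA : A.PosDef) : A.det.im = 0 :=
  (Complex.pos_iff.mp hA.det_pos).2.symm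

theorem det_re_pos {A : Matrix ι ι ℂ} (hA : A.PosDef) : 0 < A.det.re :=
  (Complex.pos_iff.mp hA.det_pos).1

theorem barrier_of_det_eq_mul {A B P : Matrix ι ι ℂ} (hA : A.PosDef) (hB : B.PosDef)
    (h : P.det = A.det * B.det) : barrier P = barrier A + barrier B := by
  simp only [barrier, h, Complex.mul_re, det_im_eq_zero hA, zero_mul, sub_zero]
  rw [Real.log_mul (det_re_pos hA).ne' (det_re_pos hB).ne']
  ring

theorem barrier_one : barrier (1 : Matrix ι ι ℂ) = 0 := by simp [barrier]

theorem barrier_inv {A : Matrix ι ι ℂ} (hA : A.PosDef) : barrier A⁻¹ = -barrier A := by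
  have h := barrier_of_det_eq_mul (P := 1) hA hA.inv (by
    rw [← Matrix.det_mul, Matrix.mul_nonsing_inv _ ((Matrix.isUnit_iff_isUnit_det A).mp hA.isUnit)])
  rw [barrier_one] at h
  linarith

theorem barrier_smul {A : Matrix ι ι ℂ} (hA : A.PosDef) {r : ℝ} (hr : 0 < r) :
    barrier (r • A) = barrier A - Fintype.card ι * Real.log r := by
  have h : (r • A).det.re = r ^ Fintype.card ι * A.det.re := by
    have : r • A = (r : ℂ) • A := by ext; simp
    rw [this, Matrix.det_smul, ← Complex.ofReal_pow, Complex.re_ofReal_mul]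
  simp only [barrier, h]
  rw [Real.log_mul (by positivity) (det_re_pos hA).ne', Real.log_pow]
  ring

theorem posDef_smul {κ : Type*} {A : Matrix κ κ ℂ} (hA : A.PosDef) {r : ℝ} (hr : 0 < r) :
    (r • A).PosDef := hA.smul hr

/-- Trace and determinant are the sum and product of the eigenvalues. Each summand is nonnegative
and vanishes only at eigenvalue `1`, which gives both the inequality and its equality case. -/
theorem trace_add_barrier_sub_card {A : Matrix ι ι ℂ} (hA : A.PosDef) :
    A.trace.re + barrier A - Fintype.card ι
      = ∑ i, (hA.1.eigenvalues i - 1 - Real.log (hA.1.eigenvalues i)) := by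
  have hpos := hA.eigenvalues_pos
  rw [barrier, hA.1.trace_eq_sum_eigenvalues, hA.1.det_eq_prod_eigenvalues]
  simp only [Complex.coe_algebraMap, ← Complex.ofReal_sum, ← Complex.ofReal_prod, Complex.ofReal_re,
    Finset.sum_sub_distrib]
  rw [Real.log_prod (fun i _ => (hpos i).ne')]
  simp
  ring

theorem card_le_trace_add_barrier {A : Matrix ι ι ℂ} (hA : A.PosDef) :
    (Fintype.card ι : ℝ) ≤ A.trace.re + barrier A := by
  have h := trace_add_barrier_sub_card hA
  have : 0 ≤ ∑ i, (hA.1.eigenvalues i - 1 - Real.log (hA.1.eigenvalues i)) :=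
    Finset.sum_nonneg fun i _ => by linarith [Real.log_le_sub_one_of_pos (hA.eigenvalues_pos i)]
  linarith

theorem eq_one_of_trace_add_barrier_eq {A : Matrix ι ι ℂ} (hA : A.PosDef)
    (heq : A.trace.re + barrier A = Fintype.card ι) : A = 1 := by
  have h := trace_add_barrier_sub_card hA
  rw [heq, sub_self, eq_comm, Finset.sum_eq_zero_iff_of_nonneg (fun i _ => by
    linarith [Real.log_le_sub_one_of_pos (hA.eigenvalues_pos i)])] at h
  have h1 : hA.1.eigenvalues = fun _ => 1 := by
    funext i
    by_contra hne
    linarith [h i (Finset.mem_univ i), Real.log_lt_sub_one_of_pos (hA.eigenvalues_pos i) hne]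
  have hs := hA.1.spectral_theorem
  rw [h1] at hs
  rw [hs]
  have : Matrix.diagonal (RCLike.ofReal ∘ fun _ : ι => (1 : ℝ)) = (1 : Matrix ι ι ℂ) := by
    ext i j; simp [Matrix.diagonal, Matrix.one_apply]
  rw [this, map_one]

/-- Conjugating by a factor of `A` reduces statements about `tr AB` to statements about `tr P`. -/
theorem exists_conj {A B : Matrix ι ι ℂ} (hA : A.PosDef) (hB : B.PosDef) :
    ∃ P : Matrix ι ι ℂ, P.PosDef ∧ P.trace = (A * B).trace ∧
      barrier P = barrier A + barrier B ∧ (P = 1 → B = A⁻¹) := by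
  obtain ⟨M, hM, rfl⟩ := exists_isUnit_conjTranspose_mul_self hA
  refine ⟨M * B * M.conjTranspose, ?_, ?_, ?_, ?_⟩
  · exact (Matrix.IsUnit.posDef_star_right_conjugate_iff hM).mpr hB
  · rw [Matrix.mul_assoc, Matrix.trace_mul_comm, Matrix.mul_assoc, Matrix.trace_mul_comm]
  · refine barrier_of_det_eq_mul hA hB ?_
    simp only [Matrix.det_mul]
    ring
  · intro h
    have hd := (Matrix.isUnit_iff_isUnit_det M).mp hM
    have hd' : IsUnit M.conjTranspose.det := by
      rw [Matrix.det_conjTranspose]; exact hd.star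
    rw [Matrix.mul_inv_rev]
    calc B = M⁻¹ * (M * B * M.conjTranspose) * M.conjTranspose⁻¹ := by
          rw [Matrix.mul_assoc, Matrix.mul_assoc, Matrix.mul_assoc,
            Matrix.mul_nonsing_inv _ hd', Matrix.mul_one, ← Matrix.mul_assoc,
            Matrix.nonsing_inv_mul _ hd, Matrix.one_mul]
      _ = _ := by rw [h, Matrix.mul_one]

/-- Besides weak duality, this is the tangent inequality of the barrier: for `A = M⁻¹` it reads
`β(B) ≥ β(M) - tr M⁻¹(B - M)`. Convexity and first-order optimality follow without differentiating
`log det`. -/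
theorem card_le_trace_mul_add_barrier {A B : Matrix ι ι ℂ} (hA : A.PosDef) (hB : B.PosDef) :
    (Fintype.card ι : ℝ) ≤ (A * B).trace.re + barrier A + barrier B := by
  obtain ⟨P, hP, h1, h2, -⟩ := exists_conj hA hB
  have := card_le_trace_add_barrier hP
  rw [h1, h2] at this
  linarith

theorem eq_inv_of_trace_mul_add_barrier_eq {A B : Matrix ι ι ℂ} (hA : A.PosDef) (hB : B.PosDef)
    (h : (A * B).trace.re + barrier A + barrier B = Fintype.card ι) : B = A⁻¹ := by
  obtain ⟨P, hP, h1, h2, h3⟩ := exists_conj hA hB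
  refine h3 (eq_one_of_trace_add_barrier_eq hP ?_)
  rw [h1, h2, ← h]
  ring

theorem trace_mul_add_barrier_eq {A : Matrix ι ι ℂ} (hA : A.PosDef) :
    (A * A⁻¹).trace.re + barrier A + barrier A⁻¹ = Fintype.card ι := by
  rw [barrier_inv hA, Matrix.mul_nonsing_inv _ ((Matrix.isUnit_iff_isUnit_det A).mp hA.isUnit)]
  simp

/-- The set of positive definite matrices is convex. -/
theorem posDef_convexCombination {κ : Type*} {A B : Matrix κ κ ℂ} (hA : A.PosDef) (hB : B.PosDef) {a b : ℝ}
    (ha : 0 ≤ a) (hb : 0 ≤ b) (hab : a + b = 1) : (a • A + b • B).PosDef := by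
  rcases ha.eq_or_lt with rfl | ha
  · have : b = 1 := by linarith
    simpa [this] using hB
  · exact (posDef_smul hA ha).add_posSemidef (hB.posSemidef.smul hb)

theorem trace_inv_convexCombination {A B : Matrix ι ι ℂ} {a b : ℝ} (hM : (a • A + b • B).PosDef) :
    a * ((a • A + b • B)⁻¹ * A).trace.re + b * ((a • A + b • B)⁻¹ * B).trace.re
      = Fintype.card ι := by
  set M := a • A + b • B with hMdef
  have : a • (M⁻¹ * A) + b • (M⁻¹ * B) = 1 := by
    rw [← Matrix.mul_smul, ← Matrix.mul_smul, ← Matrix.mul_add, ← hMdef,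
      Matrix.nonsing_inv_mul _ ((Matrix.isUnit_iff_isUnit_det M).mp hM.isUnit)]
  have h := congrArg (fun Z : Matrix ι ι ℂ => Z.trace.re) this
  simpa using h

/-- Average the tangent inequalities at the intermediate point `M`; the trace terms add up to the
size of the matrix. -/
theorem barrier_convexCombination_le {A B : Matrix ι ι ℂ} (hA : A.PosDef) (hB : B.PosDef)
    {a b : ℝ} (ha : 0 ≤ a) (hb : 0 ≤ b) (hab : a + b = 1) :
    barrier (a • A + b • B) ≤ a * barrier A + b * barrier B := by
  have hM := posDef_convexCombination hA hB ha hb hab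
  have h := trace_inv_convexCombination hM
  have h1 := card_le_trace_mul_add_barrier hM.inv hA
  have h2 := card_le_trace_mul_add_barrier hM.inv hB
  rw [barrier_inv hM] at h1 h2
  obtain rfl : a = 1 - b := by linarith
  nlinarith [mul_le_mul_of_nonneg_left h1 ha, mul_le_mul_of_nonneg_left h2 hb]

theorem barrier_convexCombination_lt {A B : Matrix ι ι ℂ} (hA : A.PosDef) (hB : B.PosDef)
    (hne : A ≠ B) {a b : ℝ} (ha : 0 < a) (hb : 0 < b) (hab : a + b = 1) :
    barrier (a • A + b • B) < a * barrier A + b * barrier B := by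
  refine lt_of_le_of_ne (barrier_convexCombination_le hA hB ha.le hb.le hab) fun heq => hne ?_
  have hM := posDef_convexCombination hA hB ha.le hb.le hab
  have h := trace_inv_convexCombination hM
  have h1 := card_le_trace_mul_add_barrier hM.inv hA
  have h2 := card_le_trace_mul_add_barrier hM.inv hB
  have k1 := fun e => eq_inv_of_trace_mul_add_barrier_eq hM.inv hA e
  have k2 := fun e => eq_inv_of_trace_mul_add_barrier_eq hM.inv hB e
  rw [barrier_inv hM] at h1 h2 k1 k2
  obtain rfl : a = 1 - b := by linarith
  -- Equality in the average forces equality in both tangent inequalities, so `A` and `B` both equal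
  -- `(M⁻¹)⁻¹`.
  have e1 : A = _ := k1 <| le_antisymm (by
    by_contra hlt
    nlinarith [mul_lt_mul_of_pos_left (not_le.mp hlt) ha, mul_le_mul_of_nonneg_left h2 hb.le]) h1
  have e2 : B = _ := k2 <| le_antisymm (by
    by_contra hlt
    nlinarith [mul_le_mul_of_nonneg_left h1 ha.le, mul_lt_mul_of_pos_left (not_le.mp hlt) hb]) h2
  exact e1.trans e2.symm

/-! ### Compactness and perturbation of positive matrices. -/

theorem norm_apply_le_trace {A : Matrix ι ι ℂ} (hA : A.PosSemidef) (i j : ι) :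
    ‖A i j‖ ≤ A.trace.re := by
  open scoped MatrixOrder in
  obtain ⟨M, rfl⟩ := CStarAlgebra.nonneg_iff_eq_star_mul_self.mp hA.nonneg
  have ht : (star M * M).trace.re = ∑ k, ∑ l, ‖M l k‖ ^ 2 := by
    simp only [Matrix.trace, Matrix.diag, Matrix.mul_apply, Matrix.star_apply, Complex.re_sum]
    refine Finset.sum_congr rfl fun k _ => Finset.sum_congr rfl fun l _ => ?_
    rw [← Complex.normSq_eq_norm_sq, Complex.normSq_apply]
    simp
  have hcol : ∀ k, ∑ l, ‖M l k‖ ^ 2 ≤ (star M * M).trace.re := fun k => by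
    rw [ht]
    exact Finset.single_le_sum (f := fun k => ∑ l, ‖M l k‖ ^ 2)
      (fun k _ => Finset.sum_nonneg fun l _ => by positivity) (Finset.mem_univ k)
  have : ‖(star M * M) i j‖ ≤ ∑ l, (‖M l i‖ ^ 2 + ‖M l j‖ ^ 2) / 2 := by
    rw [Matrix.mul_apply]
    refine (norm_sum_le _ _).trans (Finset.sum_le_sum fun l _ => ?_)
    rw [norm_mul, Matrix.star_apply, norm_star]
    nlinarith [sq_nonneg (‖M l i‖ - ‖M l j‖)]
  rw [← Finset.sum_div, Finset.sum_add_distrib] at this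
  linarith [hcol i, hcol j]

theorem isClosed_posSemidef {κ : Type*} [Fintype κ] : IsClosed {A : Matrix κ κ ℂ | A.PosSemidef} := by
  have : {A : Matrix κ κ ℂ | A.PosSemidef} = {A | A.conjTranspose = A} ∩
      ⋂ x : κ → ℂ, {A | 0 ≤ star x ⬝ᵥ (A.mulVec x)} := by
    ext A
    simp [Matrix.posSemidef_iff_dotProduct_mulVec, Matrix.IsHermitian]
  rw [this]
  refine (isClosed_eq (by fun_prop) continuous_id).inter (isClosed_iInter fun x => ?_)
  exact isClosed_Ici.preimage (by fun_prop : Continuous fun A : Matrix κ κ ℂ => star x ⬝ᵥ A.mulVec x)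

theorem isCompact_forall_norm_apply_le {κ : Type*} (c : ℝ) :
    IsCompact {A : Matrix κ κ ℂ | ∀ i j, ‖A i j‖ ≤ c} := by
  have : {A : Matrix κ κ ℂ | ∀ i j, ‖A i j‖ ≤ c} =
      Set.pi Set.univ fun _ => Set.pi Set.univ fun _ => Metric.closedBall (0 : ℂ) c := by
    ext A
    exact ⟨fun h i _ j _ => by simpa using h i j,
      fun h i j => by simpa using h i trivial j trivial⟩
  rw [this]
  exact isCompact_univ_pi fun _ => isCompact_univ_pi fun _ => isCompact_closedBall 0 c

theorem eventually_posDef_one_add_smul {K : Matrix ι ι ℂ} (hK : K.IsHermitian) :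
    ∀ᶠ t : ℝ in nhds 0, (1 + t • K).PosDef := by
  have hev : ∀ᶠ t : ℝ in nhds 0, ∀ i, 0 < 1 + t * hK.eigenvalues i := by
    refine Filter.eventually_all.mpr fun i => ?_
    have : ContinuousAt (fun t : ℝ => 1 + t * hK.eigenvalues i) 0 := by fun_prop
    exact this.eventually (lt_mem_nhds (by simp))
  filter_upwards [hev] with t ht
  have hdiag : (1 : Matrix ι ι ℂ) + t • Matrix.diagonal (RCLike.ofReal ∘ hK.eigenvalues) =
      Matrix.diagonal fun i => ((1 + t * hK.eigenvalues i : ℝ) : ℂ) := by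
    ext i j
    by_cases h : i = j <;> simp [h]
  have hs : (1 : Matrix ι ι ℂ) + t • K = Unitary.conjStarAlgAut ℂ _ hK.eigenvectorUnitary
      (Matrix.diagonal fun i => ((1 + t * hK.eigenvalues i : ℝ) : ℂ)) := by
    rw [← hdiag, map_add, map_one]
    have : t • Matrix.diagonal (RCLike.ofReal ∘ hK.eigenvalues) =
      (t : ℂ) • (Matrix.diagonal (RCLike.ofReal ∘ hK.eigenvalues) : Matrix ι ι ℂ) := by ext; simp
    rw [this, map_smul, ← hK.spectral_theorem]
    congr 1
  rw [hs, Unitary.conjStarAlgAut_apply]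
  refine (Matrix.IsUnit.posDef_star_right_conjugate_iff
    (Unitary.isUnit_coe)).mpr (Matrix.posDef_diagonal_iff.mpr fun i => ?_)
  exact_mod_cast ht i

/-- Congruence by a factor `M` of `A` reduces to `A = 1`, where the eigenvalues are `1 + tλ`. -/
theorem eventually_posDef_add_smul {A H : Matrix ι ι ℂ} (hA : A.PosDef) (hH : H.IsHermitian) :
    ∀ᶠ t : ℝ in nhds 0, (A + t • H).PosDef := by
  obtain ⟨M, hM, rfl⟩ := exists_isUnit_conjTranspose_mul_self hA
  have hd := (Matrix.isUnit_iff_isUnit_det M).mp hM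
  have hd' : IsUnit M.conjTranspose.det := by
    rw [Matrix.det_conjTranspose]; exact hd.star
  have hK : (M⁻¹.conjTranspose * H * M⁻¹).IsHermitian := by
    rw [Matrix.IsHermitian, Matrix.conjTranspose_mul, Matrix.conjTranspose_mul, hH.eq,
      Matrix.conjTranspose_conjTranspose, Matrix.mul_assoc]
  filter_upwards [eventually_posDef_one_add_smul hK] with t ht
  have h := (Matrix.IsUnit.posDef_star_left_conjugate_iff hM).mpr ht
  have hk : star M * (M⁻¹.conjTranspose * H * M⁻¹) * M = H := by
    rw [Matrix.star_eq_conjTranspose, Matrix.conjTranspose_nonsing_inv]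
    calc _ = (M.conjTranspose * M.conjTranspose⁻¹) * H * (M⁻¹ * M) := by
          simp only [Matrix.mul_assoc]
      _ = H := by rw [Matrix.mul_nonsing_inv _ hd', Matrix.nonsing_inv_mul _ hd, Matrix.one_mul,
          Matrix.mul_one]
  rwa [Matrix.mul_add, Matrix.add_mul, Matrix.mul_one, Matrix.mul_smul, Matrix.smul_mul, hk,
    Matrix.star_eq_conjTranspose] at h

/-- First-order optimality for `tr CA + ε β(A)` along a line of positive definite matrices. -/
theorem inv_trace_le_of_line_minimizer {A H C : Matrix ι ι ℂ} (hA : A.PosDef) (hH : H.IsHermitian)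
    {ε : ℝ} (hε : 0 < ε)
    (hmin : ∀ t : ℝ, (A + t • H).PosDef →
      (C * A).trace.re + ε * barrier A ≤ (C * (A + t • H)).trace.re + ε * barrier (A + t • H)) :
    ε * (A⁻¹ * H).trace.re ≤ (C * H).trace.re := by
  have hcont : ContinuousAt (fun t : ℝ => ε * ((A + t • H)⁻¹ * H).trace.re) 0 := by
    have h1 : ContinuousAt (fun t : ℝ => A + t • H) 0 := by fun_prop
    have h2 : ContinuousAt (fun B : Matrix ι ι ℂ => B⁻¹) (A + (0 : ℝ) • H) := by
      have hdet : (A + (0 : ℝ) • H).det ≠ 0 := by simpa using hA.det_pos.ne'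
      have hr : ContinuousAt (Ring.inverse : ℂ → ℂ) ((A + (0 : ℝ) • H).det) := by
        rw [Ring.inverse_eq_inv']; exact continuousAt_inv₀ hdet
      exact continuousAt_matrix_inv _ hr
    have h3 : Continuous (fun B : Matrix ι ι ℂ => ε * (B * H).trace.re) := by fun_prop
    exact h3.continuousAt.comp (f := fun t : ℝ => (A + t • H)⁻¹) 
      (ContinuousAt.comp (g := fun B : Matrix ι ι ℂ => B⁻¹) h2 h1)
  have hlim : Filter.Tendsto (fun t : ℝ => ε * ((A + t • H)⁻¹ * H).trace.re)
      (nhdsWithin 0 (Set.Ioi 0)) (nhds (ε * (A⁻¹ * H).trace.re)) := by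
    have := hcont.tendsto.mono_left (nhdsWithin_le_nhds (s := Set.Ioi 0))
    simpa using this
  refine le_of_tendsto hlim ?_
  filter_upwards [(eventually_posDef_add_smul hA hH).filter_mono nhdsWithin_le_nhds,
    self_mem_nhdsWithin] with t ht htpos
  rw [Set.mem_Ioi] at htpos
  have h1 := hmin t ht
  -- The tangent is taken at the moved point `A + tH` and bounds `β(A)` from below. Dividing by `t >
  -- 0` and letting `t → 0` gives the claim by continuity of the inverse.
  have h2 := card_le_trace_mul_add_barrier ht.inv hA
  rw [barrier_inv ht] at h2
  have h3 : (Fintype.card ι : ℝ) =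
      ((A + t • H)⁻¹ * A).trace.re + t * ((A + t • H)⁻¹ * H).trace.re := by
    have := congrArg (fun Z : Matrix ι ι ℂ => Z.trace.re)
      (Matrix.nonsing_inv_mul _ ((Matrix.isUnit_iff_isUnit_det _).mp ht.isUnit))
    rw [Matrix.mul_add] at this
    simpa using this.symm
  have h4 : (C * (A + t • H)).trace.re = (C * A).trace.re + t * (C * H).trace.re := by
    rw [Matrix.mul_add]; simp
  have h5 : t * ((A + t • H)⁻¹ * H).trace.re ≤ barrier A - barrier (A + t • H) := by linarith
  have h6 := mul_le_mul_of_nonneg_left h5 hε.le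
  refine le_of_mul_le_mul_left ?_ htpos
  linarith

end Matrices

/-! ### Tensor products, partial traces and one-factor embeddings. -/

section TensorPower

variable {d n : ℕ}

theorem tensor_mul (A B : Fin d → Mat n) :
    tensor A * tensor B = tensor fun k => A k * B k := by
  ext a b
  simp only [tensor, Matrix.mul_apply, Matrix.of_apply, Fintype.prod_sum, Finset.prod_mul_distrib]

theorem tensor_conjTranspose (A : Fin d → Mat n) :
    (tensor A).conjTranspose = tensor fun k => (A k).conjTranspose := by
  ext a b
  simp [tensor, Matrix.conjTranspose_apply]

theorem tensor_one : tensor (fun _ : Fin d => (1 : Mat n)) = 1 := by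
  ext a b
  simp only [tensor, Matrix.of_apply, Matrix.one_apply]
  rw [Finset.prod_ite_zero]
  simp [funext_iff]

theorem posDef_tensor {A : Fin d → Mat n} (hA : ∀ k, (A k).PosDef) : (tensor A).PosDef := by
  choose M hM hMA using fun k => exists_isUnit_conjTranspose_mul_self (hA k)
  have hfac : tensor A = star (tensor M) * 1 * tensor M := by
    rw [Matrix.mul_one, Matrix.star_eq_conjTranspose, tensor_conjTranspose, tensor_mul]
    exact congrArg tensor (funext hMA)
  have hunit : IsUnit (tensor M) := by
    refine (Matrix.isUnit_iff_isUnit_det _).mpr (Matrix.isUnit_det_of_right_inverse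
      (B := tensor fun k => (M k)⁻¹) ?_)
    rw [tensor_mul, ← tensor_one]
    exact congrArg tensor (funext fun k =>
      Matrix.mul_nonsing_inv _ ((Matrix.isUnit_iff_isUnit_det _).mp (hM k)))
  rw [hfac]
  exact (Matrix.IsUnit.posDef_star_left_conjugate_iff hunit).mpr Matrix.PosDef.one

theorem marginal_tensor (j : Fin d) (A : Fin d → Mat n) :
    marginal j (tensor A) = (∏ k ∈ Finset.univ.erase j, (A k).trace) • A j := by
  ext p q
  simp only [marginal, tensor, Matrix.of_apply, Matrix.smul_apply, smul_eq_mul]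
  -- The constraint `a j = p` is absorbed into the `j`-th factor, so the sum over multi-indices
  -- splits into a product of sums.
  set F : Fin d → Fin n → ℂ :=
    fun k x => if k = j then (if x = p then A j p q else 0) else A k x x with hF
  have h1 : ∀ a : Fin d → Fin n, (if a j = p then ∏ k, A k (a k) (Function.update a j q k) else 0)
      = ∏ k, F k (a k) := by
    intro a
    rw [← Finset.mul_prod_erase _ _ (Finset.mem_univ j),
      ← Finset.mul_prod_erase _ (fun k => F k (a k)) (Finset.mem_univ j)]
    have h2 : ∏ k ∈ Finset.univ.erase j, A k (a k) (Function.update a j q k) =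
        ∏ k ∈ Finset.univ.erase j, F k (a k) :=
      Finset.prod_congr rfl fun k hk => by
        simp [hF, Finset.ne_of_mem_erase hk]
    rw [h2]
    by_cases h : a j = p
    · simp [hF, h]
    · simp [hF, h]
  rw [Finset.sum_filter, Finset.sum_congr rfl fun a _ => h1 a, ← Fintype.prod_sum,
    ← Finset.mul_prod_erase _ _ (Finset.mem_univ j), mul_comm]
  congr 1
  · exact Finset.prod_congr rfl fun k hk => by
      simp [hF, Finset.ne_of_mem_erase hk, Matrix.trace]
  · simp [hF]

theorem marginal_add (j : Fin d) (ρ σ : MultiMat d n) :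
    marginal j (ρ + σ) = marginal j ρ + marginal j σ := by
  ext p q
  simp [marginal, Finset.sum_add_distrib]

theorem marginal_smul (j : Fin d) (c : ℂ) (ρ : MultiMat d n) :
    marginal j (c • ρ) = c • marginal j ρ := by
  ext p q
  simp [marginal, Finset.mul_sum]

/-- The partial trace as a linear map. -/
def marginalₗ (j : Fin d) : MultiMat d n →ₗ[ℂ] Mat n where
  toFun := marginal j
  map_add' := marginal_add j
  map_smul' := marginal_smul j

@[simp] theorem marginalₗ_apply (j : Fin d) (ρ : MultiMat d n) : marginalₗ j ρ = marginal j ρ := rfl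

theorem marginal_conjTranspose (j : Fin d) (ρ : MultiMat d n) :
    marginal j ρ.conjTranspose = (marginal j ρ).conjTranspose := by
  ext p q
  simp only [marginal, Matrix.of_apply, Matrix.conjTranspose_apply, star_sum]
  refine Finset.sum_bij' (fun a _ => Function.update a j q) (fun a _ => Function.update a j p)
    ?_ ?_ ?_ ?_ ?_
  · simp
  · simp
  · intro a ha
    simp only [Finset.mem_filter, Finset.mem_univ, true_and] at ha
    simp [← ha]
  · intro a ha
    simp only [Finset.mem_filter, Finset.mem_univ, true_and] at ha
    simp [← ha]
  · intro a ha
    simp only [Finset.mem_filter, Finset.mem_univ, true_and] at ha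
    simp [← ha]

theorem trace_marginal (j : Fin d) (ρ : MultiMat d n) : (marginal j ρ).trace = ρ.trace := by
  simp only [marginal, Matrix.trace, Matrix.diag, Matrix.of_apply]
  rw [← Finset.sum_fiberwise (s := Finset.univ) (g := fun a : Fin d → Fin n => a j)]
  refine Finset.sum_congr rfl fun p _ => Finset.sum_congr rfl fun a ha => ?_
  simp only [Finset.mem_filter, Finset.mem_univ, true_and] at ha
  simp [← ha]

theorem continuous_marginal (j : Fin d) : Continuous (marginal j : MultiMat d n → Mat n) := by
  unfold marginal
  fun_prop

theorem lift_apply (j : Fin d) (X : Mat n) (a b : Fin d → Fin n) :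
    lift j X a b = if Function.update b j (a j) = a then X (a j) (b j) else 0 := by
  simp only [lift, tensor, Matrix.of_apply]
  rw [← Finset.mul_prod_erase _ _ (Finset.mem_univ j)]
  have h2 : ∏ k ∈ Finset.univ.erase j,
      Function.update (fun _ => (1 : Mat n)) j X k (a k) (b k) =
        ∏ k ∈ Finset.univ.erase j, if a k = b k then (1 : ℂ) else 0 :=
    Finset.prod_congr rfl fun k hk => by
      simp [Finset.ne_of_mem_erase hk, Matrix.one_apply]
  rw [h2, Finset.prod_ite_zero]
  have h3 : (∀ k ∈ Finset.univ.erase j, a k = b k) ↔ Function.update b j (a j) = a := by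
    rw [Function.update_eq_iff]
    simp [eq_comm]
  simp only [h3, Function.update_self, mul_ite, mul_one, mul_zero, Finset.prod_const_one]

/-- `X ↦ I ⊗ ⋯ ⊗ X ⊗ ⋯ ⊗ I` as a linear map. -/
def liftₗ (j : Fin d) : Mat n →ₗ[ℂ] MultiMat d n where
  toFun := lift j
  map_add' X Y := by
    ext a b
    simp only [lift_apply, Matrix.add_apply]
    split_ifs <;> simp
  map_smul' c X := by
    ext a b
    simp only [lift_apply, Matrix.smul_apply, RingHom.id_apply]
    split_ifs <;> simp

@[simp] theorem liftₗ_apply (j : Fin d) (X : Mat n) : liftₗ j X = lift j X := rfl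

theorem lift_one (j : Fin d) : lift j (1 : Mat n) = 1 := by
  rw [lift, Function.update_eq_self_iff.mpr rfl, tensor_one]

theorem lift_conjTranspose (j : Fin d) (X : Mat n) :
    (lift j X).conjTranspose = lift j X.conjTranspose := by
  rw [lift, tensor_conjTranspose, lift]
  congr 1
  funext k
  by_cases h : k = j
  · subst h; simp
  · simp [h]

/-- `lift j` and `marginal j` are adjoint for the trace pairing; this turns the marginal constraints
into the linear term of the dual function. -/
theorem trace_lift_mul (j : Fin d) (X : Mat n) (ρ : MultiMat d n) :
    (lift j X * ρ).trace = (marginal j ρ * X).trace := by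
  rw [Matrix.trace_mul_comm]
  simp only [Matrix.trace, Matrix.diag, Matrix.mul_apply, marginal, Matrix.of_apply, lift_apply,
    Finset.sum_mul]
  have h1 : ∀ a : Fin d → Fin n,
      ∑ b, ρ a b * (if Function.update a j (b j) = b then X (b j) (a j) else 0)
        = ∑ q, ρ a (Function.update a j q) * X q (a j) := by
    intro a
    simp only [mul_ite, mul_zero]
    rw [← Finset.sum_filter]
    refine Finset.sum_bij' (fun b _ => b j) (fun q _ => Function.update a j q) ?_ ?_ ?_ ?_ ?_
    · simp
    · simp
    · intro b hb
      exact (Finset.mem_filter.mp hb).2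
    · simp
    · intro b hb
      rw [(Finset.mem_filter.mp hb).2]
  rw [Finset.sum_congr rfl fun a _ => h1 a,
    ← Finset.sum_fiberwise (s := Finset.univ) (g := fun a : Fin d → Fin n => a j)]
  refine Finset.sum_congr rfl fun p _ => ?_
  rw [Finset.sum_comm]
  refine Finset.sum_congr rfl fun q _ => Finset.sum_congr rfl fun a ha => ?_
  rw [(Finset.mem_filter.mp ha).2]

theorem marginal_lift_self (j : Fin d) (X : Mat n) :
    marginal j (lift j X) = (n : ℂ) ^ (d - 1) • X := by
  rw [lift, marginal_tensor, Function.update_self]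
  congr 1
  rw [Finset.prod_congr rfl (g := fun _ => (n : ℂ)) fun k hk => by
    simp [Finset.ne_of_mem_erase hk]]
  simp

theorem marginal_lift_of_ne {j k : Fin d} (h : k ≠ j) (X : Mat n) :
    marginal k (lift j X) = ((n : ℂ) ^ (d - 2) * X.trace) • (1 : Mat n) := by
  rw [lift, marginal_tensor, Function.update_of_ne h]
  congr 1
  rw [← Finset.mul_prod_erase _ _ (Finset.mem_erase.mpr ⟨h.symm, Finset.mem_univ j⟩),
    Function.update_self, mul_comm]
  congr 1
  rw [Finset.prod_congr rfl (g := fun _ => (n : ℂ)) fun l hl => by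
    simp [Finset.ne_of_mem_erase hl]]
  rw [Finset.prod_const, Finset.card_erase_of_mem (Finset.mem_erase.mpr ⟨h.symm, Finset.mem_univ j⟩),
    Finset.card_erase_of_mem (Finset.mem_univ k), Finset.card_fin, Nat.sub_sub]

/-- The sum `∑ⱼ I ⊗ ⋯ ⊗ Xⱼ ⊗ ⋯ ⊗ I` as a linear map. -/
def liftSum : (Fin d → Mat n) →ₗ[ℂ] MultiMat d n := ∑ j, (liftₗ j).comp (LinearMap.proj j)

theorem liftSum_apply (X : Fin d → Mat n) : liftSum X = ∑ j, lift j (X j) := by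
  simp [liftSum]

theorem liftSum_conjTranspose (X : Fin d → Mat n) :
    (liftSum X).conjTranspose = liftSum fun j => (X j).conjTranspose := by
  simp only [liftSum_apply, Matrix.conjTranspose_sum, lift_conjTranspose]

theorem liftSum_scalar (c : Fin d → ℂ) :
    liftSum (fun j => c j • (1 : Mat n)) = (∑ j, c j) • (1 : MultiMat d n) := by
  rw [liftSum_apply, Finset.sum_smul]
  refine Finset.sum_congr rfl fun j _ => ?_
  rw [← liftₗ_apply, map_smul, liftₗ_apply, lift_one]

theorem trace_liftSum_mul (X : Fin d → Mat n) (ρ : MultiMat d n) :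
    (liftSum X * ρ).trace = ∑ j, (marginal j ρ * X j).trace := by
  rw [liftSum_apply, Finset.sum_mul, Matrix.trace_sum]
  exact Finset.sum_congr rfl fun j _ => trace_lift_mul j _ ρ

/-- Up to scalar matrices, taking marginals inverts `liftSum`. Both its kernel and the solvability
of prescribed marginals are read off from this formula. -/
theorem marginal_liftSum (k : Fin d) (X : Fin d → Mat n) :
    marginal k (liftSum X) = (n : ℂ) ^ (d - 1) • X k +
      ((n : ℂ) ^ (d - 2) * ∑ j ∈ Finset.univ.erase k, (X j).trace) • (1 : Mat n) := by
  rw [liftSum_apply, ← marginalₗ_apply, map_sum, ← Finset.add_sum_erase _ _ (Finset.mem_univ k),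
    marginalₗ_apply, marginal_lift_self, Finset.mul_sum, Finset.sum_smul]
  congr 1
  exact Finset.sum_congr rfl fun j hj => marginal_lift_of_ne (Finset.ne_of_mem_erase hj).symm _

/-- A tuple with `∑ⱼ I ⊗ ⋯ ⊗ Xⱼ ⊗ ⋯ ⊗ I = 0` consists of scalars that add up to zero. -/
theorem exists_scalar_of_liftSum_eq_zero (hn : n ≠ 0) {X : Fin d → Mat n}
    (h : liftSum X = 0) : ∃ c : Fin d → ℂ, ∑ j, c j = 0 ∧ ∀ j, X j = c j • (1 : Mat n) := by
  have hn' : (n : ℂ) ≠ 0 := Nat.cast_ne_zero.mpr hn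
  have hpow : (n : ℂ) ^ (d - 1) ≠ 0 := pow_ne_zero _ hn'
  have hX : ∀ k, ∃ c : ℂ, X k = c • (1 : Mat n) := fun k => by
    have hk := marginal_liftSum k X
    rw [h, ← marginalₗ_apply, map_zero, eq_comm, add_eq_zero_iff_eq_neg, ← neg_smul] at hk
    refine ⟨((n : ℂ) ^ (d - 1))⁻¹ *
      -((n : ℂ) ^ (d - 2) * ∑ j ∈ Finset.univ.erase k, (X j).trace), ?_⟩
    rw [mul_smul, ← hk, smul_smul, inv_mul_cancel₀ hpow, one_smul]
  choose c hc using hX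
  refine ⟨c, ?_, hc⟩
  rw [funext hc, liftSum_scalar] at h
  have : Nonempty (Fin n) := ⟨⟨0, Nat.pos_of_ne_zero hn⟩⟩
  exact (smul_eq_zero.mp h).resolve_right one_ne_zero

/-- Every matrix agrees with some `∑ⱼ I ⊗ ⋯ ⊗ Xⱼ ⊗ ⋯ ⊗ I` up to a matrix with zero marginals. -/
theorem exists_liftSum_marginal_eq (hd : 2 ≤ d) (hn : n ≠ 0) {G : MultiMat d n}
    (hG : G.IsHermitian) : ∃ X : Fin d → Mat n, (∀ j, (X j).IsHermitian) ∧
      ∀ j, marginal j (liftSum X) = marginal j G := by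
  have hn' : (n : ℂ) ≠ 0 := Nat.cast_ne_zero.mpr hn
  obtain ⟨e, rfl⟩ := Nat.exists_eq_add_of_le' hd
  have htr : star G.trace = G.trace := by
    rw [← Matrix.trace_conjTranspose, hG.eq]
  have hM : ∀ j, (marginal j G).conjTranspose = marginal j G := fun j => by
    rw [← marginal_conjTranspose, hG.eq]
  -- Here `d = e + 2`. All marginals of `G` have trace `tr G`, so the ansatz `n^(1-d) G_j - c I`
  -- leaves one scalar equation, solved by `c = (d-1) tr G / (d n^d)`.
  refine ⟨fun j => ((n : ℂ) ^ (e + 1))⁻¹ • marginal j G -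
    ((e + 1) * ((e + 2) * (n : ℂ) ^ (e + 2))⁻¹ * G.trace) • (1 : Mat n), fun j => ?_, fun k => ?_⟩
  · rw [Matrix.IsHermitian, Matrix.conjTranspose_sub, Matrix.conjTranspose_smul,
      Matrix.conjTranspose_smul, hM, Matrix.conjTranspose_one]
    simp only [star_mul', star_inv₀, star_pow, star_add, star_natCast, star_one, htr]
    simp
  · rw [marginal_liftSum]
    have h2 : (e : ℂ) + 2 ≠ 0 := by exact_mod_cast (Nat.succ_ne_zero (e + 1))
    simp only [Matrix.trace_sub, Matrix.trace_smul, trace_marginal, Matrix.trace_one,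
      Finset.sum_const, Finset.card_erase_of_mem (Finset.mem_univ k), Finset.card_fin,
      Fintype.card_fin, show e + 2 - 1 = e + 1 from rfl, show e + 2 - 2 = e from rfl]
    ext p q
    simp only [Matrix.add_apply, Matrix.sub_apply, Matrix.smul_apply, smul_eq_mul, nsmul_eq_mul]
    push_cast
    field_simp
    ring

end TensorPower

/-! ### Concavity, shifts, the duality gap and optimality. -/

section Duality

variable {d n : ℕ} {C : MultiMat d n} {R : Fin d → Mat n} {ε : ℝ}

theorem slack_eq (C : MultiMat d n) (X : Fin d → Mat n) : slack C X = C - liftSum X := by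
  rw [slack, liftSum_apply]

theorem slack_convexCombination (C : MultiMat d n) (X Y : Fin d → Mat n) {a b : ℝ}
    (hab : a + b = 1) : slack C (a • X + b • Y) = a • slack C X + b • slack C Y := by
  simp only [slack_eq, map_add, LinearMap.map_smul_of_tower, smul_sub]
  nth_rewrite 1 [← one_smul ℝ C]
  rw [← hab, add_smul]
  abel

theorem isHermitian_convexCombination {X Y : Mat n} (hX : X.IsHermitian) (hY : Y.IsHermitian)
    (a b : ℝ) : (a • X + b • Y).IsHermitian := by
  rw [Matrix.IsHermitian, Matrix.conjTranspose_add, Matrix.conjTranspose_smul,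
    Matrix.conjTranspose_smul, hX.eq, hY.eq]
  simp

theorem convex_domainHat (C : MultiMat d n) : Convex ℝ (domainHat C) := by
  intro X hX Y hY a b ha hb hab
  refine ⟨fun j => isHermitian_convexCombination (hX.1 j) (hY.1 j) a b, ?_⟩
  rw [slack_convexCombination C X Y hab]
  exact posDef_convexCombination hX.2 hY.2 ha hb hab

theorem convex_domain (C : MultiMat d n) : Convex ℝ (domain C) := by
  intro X hX Y hY a b ha hb hab
  refine ⟨convex_domainHat C hX.1 hY.1 ha hb hab, fun i j => ?_⟩
  simp [hX.2 i j, hY.2 i j]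

theorem dual_convexCombination (C : MultiMat d n) (R : Fin d → Mat n) (ε : ℝ)
    (X Y : Fin d → Mat n) {a b : ℝ} (hab : a + b = 1) :
    dual C R ε (a • X + b • Y) - (a * dual C R ε X + b * dual C R ε Y) =
      ε * (a * barrier (slack C X) + b * barrier (slack C Y) -
        barrier (a • slack C X + b • slack C Y)) := by
  have h : ∑ j, (R j * (a • X + b • Y) j).trace.re =
      a * ∑ j, (R j * X j).trace.re + b * ∑ j, (R j * Y j).trace.re := by
    rw [Finset.mul_sum, Finset.mul_sum, ← Finset.sum_add_distrib]
    refine Finset.sum_congr rfl fun j _ => ?_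
    simp [Matrix.mul_add]
  obtain rfl : a = 1 - b := by linarith
  rw [dual, dual, dual, h, slack_convexCombination C X Y hab]
  ring

theorem concaveOn_dual (C : MultiMat d n) (R : Fin d → Mat n) (hε : 0 < ε) :
    ConcaveOn ℝ (domainHat C) (dual C R ε) := by
  refine ⟨convex_domainHat C, fun X hX Y hY a b ha hb hab => ?_⟩
  have h := dual_convexCombination C R ε X Y hab
  have h1 := barrier_convexCombination_le hX.2 hY.2 ha hb hab
  have h2 := mul_nonneg hε.le (sub_nonneg.mpr h1)
  simp only [smul_eq_mul]
  linarith

theorem trace_im_eq_zero {ι : Type*} [Fintype ι] {A : Matrix ι ι ℂ} (hA : A.IsHermitian) :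
    A.trace.im = 0 := by
  refine Complex.conj_eq_iff_im.mp ?_
  rw [starRingEnd_apply, ← Matrix.trace_conjTranspose, hA.eq]

/-- Tuples of Hermitian matrices with the same slack differ by a shift. -/
theorem mem_shifts_of_slack_eq (hn : n ≠ 0) {X U : Fin d → Mat n} (hX : ∀ j, (X j).IsHermitian)
    (hU : ∀ j, (U j).IsHermitian) (h : slack C X = slack C U) : X ∈ shifts U := by
  have h0 : liftSum (X - U) = 0 := by
    rw [slack_eq, slack_eq, sub_right_inj] at h
    rw [map_sub, h, sub_self]
  obtain ⟨c, hc, hXc⟩ := exists_scalar_of_liftSum_eq_zero hn h0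
  -- The scalars are a priori complex; the trace `n c_j` of a Hermitian difference is real.
  have hre : ∀ j, X j = U j + (c j).re • (1 : Mat n) := fun j => by
    have him := trace_im_eq_zero ((hX j).sub (hU j))
    rw [← Pi.sub_apply, hXc j] at him
    have hcim : (c j).im = 0 := by
      simpa [hn] using him
    have h1 : c j = ((c j).re : ℂ) := by
      apply Complex.ext <;> simp [hcim]
    rw [← sub_eq_iff_eq_add', ← Pi.sub_apply, hXc j]
    conv_lhs => rw [h1]
    ext p q
    simp
  refine ⟨fun j => (c j).re, ?_, hre⟩
  rw [← Complex.re_sum, hc, Complex.zero_re]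

theorem slack_eq_of_mem_shifts {X U : Fin d → Mat n} (h : X ∈ shifts U) :
    slack C X = slack C U := by
  obtain ⟨t, ht, hX⟩ := h
  have hXU : X = U + fun j => (t j : ℂ) • (1 : Mat n) := by
    funext j
    rw [hX j, Pi.add_apply]
    congr 1
  rw [slack_eq, slack_eq, hXU, map_add, liftSum_scalar, ← Complex.ofReal_sum, ht]
  simp

theorem isHermitian_of_mem_shifts {X U : Fin d → Mat n} (hU : ∀ j, (U j).IsHermitian)
    (h : X ∈ shifts U) (j : Fin d) : (X j).IsHermitian := by
  obtain ⟨t, -, hX⟩ := h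
  rw [hX j]
  simpa using isHermitian_convexCombination (hU j) Matrix.isHermitian_one 1 (t j)

theorem eq_of_mem_shifts_of_trace_eq (hn : n ≠ 0) {X U : Fin d → Mat n} (h : X ∈ shifts U)
    (hX : ∀ i j, (X i).trace = (X j).trace) (hU : ∀ i j, (U i).trace = (U j).trace) : X = U := by
  obtain ⟨t, ht, hXt⟩ := h
  have hconst : ∀ i j, t i = t j := fun i j => by
    have := congrArg Complex.re (hX i j)
    rw [hXt i, hXt j, Matrix.trace_add, Matrix.trace_add, hU i j] at this
    simpa [hn] using this
  funext j
  have hj : t j = 0 := by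
    rw [Finset.sum_congr rfl fun i _ => hconst i j, Finset.sum_const, Finset.card_fin,
      nsmul_eq_mul] at ht
    exact (mul_eq_zero.mp ht).resolve_left (Nat.cast_ne_zero.mpr j.pos.ne')
  rw [hXt j, hj, zero_smul, add_zero]

/-- Every tuple of Hermitian matrices has a shift with equal traces. -/
theorem exists_mem_shifts_trace_eq (hn : n ≠ 0) {X : Fin d → Mat n}
    (hX : ∀ j, (X j).IsHermitian) :
    ∃ U ∈ shifts X, ∀ i j, (U i).trace = (U j).trace := by
  have hn' : (n : ℝ) ≠ 0 := Nat.cast_ne_zero.mpr hn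
  -- The common trace must be the mean of the traces for the shifts to sum to zero.
  set m : ℝ := (∑ j, (X j).trace.re) / d with hm
  have htr : ∀ j, (X j + ((m - (X j).trace.re) / n) • (1 : Mat n)).trace = m := fun j => by
    have him := trace_im_eq_zero (hX j)
    apply Complex.ext
    · simp only [Matrix.trace_add, Matrix.trace_smul, Matrix.trace_one, Fintype.card_fin,
        Complex.add_re, Complex.smul_re, Complex.natCast_re, Complex.ofReal_re, smul_eq_mul]
      field_simp
      ring
    · simp [him]
  refine ⟨fun j => X j + ((m - (X j).trace.re) / n) • (1 : Mat n), ⟨_, ?_, fun j => rfl⟩,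
    fun i j => by rw [htr i, htr j]⟩
  rw [← Finset.sum_div, Finset.sum_sub_distrib, Finset.sum_const, Finset.card_fin, nsmul_eq_mul, hm]
  rcases Nat.eq_zero_or_pos d with rfl | hd
  · simp
  · have : (d : ℝ) ≠ 0 := Nat.cast_ne_zero.mpr hd.ne'
    field_simp
    simp

theorem strictConcaveOn_dual (hn : n ≠ 0) (C : MultiMat d n) (R : Fin d → Mat n) (hε : 0 < ε) :
    StrictConcaveOn ℝ (domain C) (dual C R ε) := by
  refine ⟨convex_domain C, fun X hX Y hY hne a b ha hb hab => ?_⟩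
  have hslack : slack C X ≠ slack C Y := fun h =>
    hne (eq_of_mem_shifts_of_trace_eq hn (mem_shifts_of_slack_eq hn hX.1.1 hY.1.1 h) hX.2 hY.2)
  have h := dual_convexCombination C R ε X Y hab
  have h1 := barrier_convexCombination_lt hX.1.2 hY.1.2 hslack ha hb hab
  have h2 := mul_pos hε (sub_pos.mpr h1)
  simp only [smul_eq_mul]
  linarith

/-- The duality gap is a gap in the trace-determinant inequality. -/
theorem objective_sub_dual (hε : 0 < ε) {ρ : MultiMat d n} (hρ : ρ ∈ couplingInt R)
    (X : Fin d → Mat n) : objective C ε ρ - dual C R ε X =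
      ε * ((slack C X * (ε⁻¹ • ρ)).trace.re + barrier (slack C X) + barrier (ε⁻¹ • ρ) -
        Fintype.card (Fin d → Fin n)) := by
  have h1 : (slack C X * ρ).trace.re = (C * ρ).trace.re - ∑ j, (R j * X j).trace.re := by
    rw [slack_eq, Matrix.sub_mul, Matrix.trace_sub, trace_liftSum_mul, Complex.sub_re,
      Complex.re_sum]
    simp only [hρ.1.2]
  -- Rescaling `ρ` by `ε⁻¹` adds `n^d log ε` to the barrier; with the subtracted size `n^d` this
  -- accounts for the constant in `dual`.
  rw [barrier_smul hρ.2 (inv_pos.mpr hε), Matrix.mul_smul, Matrix.trace_smul, Complex.smul_re, h1,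
    Real.log_inv, objective, dual]
  simp only [Fintype.card_pi, Fintype.card_fin, Finset.prod_const, Finset.card_fin, smul_eq_mul]
  push_cast
  field_simp
  ring

theorem dual_le_objective (hε : 0 < ε) {ρ : MultiMat d n} (hρ : ρ ∈ couplingInt R)
    {X : Fin d → Mat n} (hX : X ∈ domainHat C) : dual C R ε X ≤ objective C ε ρ := by
  have h := objective_sub_dual (C := C) hε hρ X
  have h1 := card_le_trace_mul_add_barrier hX.2 (posDef_smul hρ.2 (inv_pos.mpr hε))
  have h2 := mul_nonneg hε.le (sub_nonneg.mpr h1)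
  linarith

theorem dual_eq_objective_iff (hε : 0 < ε) {ρ : MultiMat d n} (hρ : ρ ∈ couplingInt R)
    {X : Fin d → Mat n} (hX : X ∈ domainHat C) :
    dual C R ε X = objective C ε ρ ↔ ρ = ε • (slack C X)⁻¹ := by
  have h := objective_sub_dual (C := C) hε hρ X
  have h3 : ε⁻¹ • ρ = (slack C X)⁻¹ ↔ ρ = ε • (slack C X)⁻¹ := inv_smul_eq_iff₀ hε.ne'
  rw [← h3]
  refine ⟨fun heq => ?_, fun heq => ?_⟩
  · refine eq_inv_of_trace_mul_add_barrier_eq hX.2 (posDef_smul hρ.2 (inv_pos.mpr hε)) ?_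
    rw [heq, sub_self, eq_comm] at h
    exact sub_eq_zero.mp ((mul_eq_zero.mp h).resolve_left hε.ne')
  · rw [heq, trace_mul_add_barrier_eq hX.2, sub_self, mul_zero] at h
    linarith

theorem couplingInt_nonempty (hd : d ≠ 0) (hn : n ≠ 0) (hR : R ∈ balanced d n) :
    (couplingInt R).Nonempty := by
  have : Nonempty (Fin n) := ⟨⟨0, Nat.pos_of_ne_zero hn⟩⟩
  obtain ⟨j₀⟩ : Nonempty (Fin d) := ⟨⟨0, Nat.pos_of_ne_zero hd⟩⟩
  obtain ⟨hpos, him⟩ := Complex.pos_iff.mp (hR.1 j₀).trace_pos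
  set τ : ℝ := (R j₀).trace.re with hτ
  have htr : ∀ j, (R j).trace = (τ : ℂ) := fun j => by
    rw [hR.2 j j₀]
    apply Complex.ext <;> simp [hτ, ← him]
  -- The product coupling: each marginal of `tensor R` carries the other `d - 1` traces, all equal
  -- to `τ`.
  have hpd : ((τ ^ (d - 1))⁻¹ • tensor R).PosDef :=
    posDef_smul (posDef_tensor hR.1) (by positivity)
  refine ⟨_, ⟨hpd.posSemidef, fun j => ?_⟩, hpd⟩
  rw [← marginalₗ_apply, LinearMap.map_smul_of_tower, marginalₗ_apply, marginal_tensor,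
    Finset.prod_congr rfl fun k _ => htr k, Finset.prod_const,
    Finset.card_erase_of_mem (Finset.mem_univ j), Finset.card_fin]
  have hne : (τ : ℂ) ^ (d - 1) ≠ 0 := pow_ne_zero _ (by exact_mod_cast hpos.ne')
  ext p q
  simp only [Matrix.smul_apply, Complex.real_smul, smul_eq_mul]
  push_cast
  rw [inv_mul_cancel_left₀ hne]

/-- One marginal already fixes the trace, which bounds every entry of a positive semidefinite
matrix. -/
theorem isCompact_coupling (hd : d ≠ 0) (R : Fin d → Mat n) : IsCompact (coupling R) := by
  have hclosed : IsClosed (coupling R) := by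
    have : coupling R = {ρ | ρ.PosSemidef} ∩ ⋂ j, {ρ | marginal j ρ = R j} := by
      ext ρ
      simp [coupling]
    rw [this]
    exact isClosed_posSemidef.inter (isClosed_iInter fun j =>
      isClosed_eq (continuous_marginal j) continuous_const)
  let j₀ : Fin d := ⟨0, Nat.pos_of_ne_zero hd⟩
  refine (isCompact_forall_norm_apply_le (R j₀).trace.re).of_isClosed_subset hclosed ?_
  intro ρ hρ a b
  rw [← hρ.2 j₀, trace_marginal]
  exact norm_apply_le_trace hρ.1 a b

theorem continuous_trace_mul_re (C : MultiMat d n) :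
    Continuous fun ρ : MultiMat d n => (C * ρ).trace.re := by
  fun_prop

theorem continuous_det_re : Continuous fun ρ : MultiMat d n => ρ.det.re := by
  fun_prop

/-- The relaxed primal problem has a solution. -/
theorem exists_isMinOn_objective (hd : d ≠ 0) (hn : n ≠ 0) (hR : R ∈ balanced d n)
    (C : MultiMat d n) (hε : 0 < ε) :
    ∃ ρ ∈ couplingInt R, IsMinOn (objective C ε) (couplingInt R) ρ := by
  obtain ⟨ρ₀, hρ₀⟩ := couplingInt_nonempty hd hn hR
  obtain ⟨m, hm⟩ := ((isCompact_coupling hd R).image (continuous_trace_mul_re C)).bddBelow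
  -- Since the linear term is at least `m`, an objective no larger than at `ρ₀` forces `det ρ ≥ δ`.
  -- The search is thus confined to a compact set of positive definite couplings.
  set δ : ℝ := Real.exp (-((objective C ε ρ₀ - m) / ε)) with hδ
  have hδpos : 0 < δ := Real.exp_pos _
  have hsub : ∀ ρ ∈ couplingInt R, objective C ε ρ ≤ objective C ε ρ₀ → δ ≤ ρ.det.re := by
    intro ρ hρ hle
    have h1 : m ≤ (C * ρ).trace.re := hm ⟨ρ, hρ.1, rfl⟩
    rw [hδ, ← Real.le_log_iff_exp_le (det_re_pos hρ.2), neg_le, le_div_iff₀ hε]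
    rw [objective, barrier] at hle
    linarith
  set K : Set (MultiMat d n) := coupling R ∩ {ρ | δ ≤ ρ.det.re} with hK
  have hKc : IsCompact K :=
    (isCompact_coupling hd R).inter_right (isClosed_le continuous_const continuous_det_re)
  have hKsub : K ⊆ couplingInt R := fun ρ hρ =>
    ⟨hρ.1, hρ.1.1.posDef_iff_det_ne_zero.mpr fun h => by
      have := hρ.2
      simp only [Set.mem_ofPred_eq, h, Complex.zero_re] at this
      linarith⟩
  have hcont : ContinuousOn (objective C ε) K := by
    refine (continuous_trace_mul_re C).continuousOn.add (continuousOn_const.mul ?_)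
    exact (continuous_det_re.continuousOn.log fun ρ hρ => (det_re_pos (hKsub hρ).2).ne').neg
  have hρ₀K : ρ₀ ∈ K := ⟨hρ₀.1, hsub ρ₀ hρ₀ le_rfl⟩
  obtain ⟨ρ, hρ, hmin⟩ := hKc.exists_isMinOn ⟨ρ₀, hρ₀K⟩ hcont
  refine ⟨ρ, hKsub hρ, fun σ hσ => ?_⟩
  by_cases hle : objective C ε σ ≤ objective C ε ρ₀
  · exact hmin ⟨hσ.1, hsub σ hσ hle⟩
  · exact (hmin hρ₀K).trans (not_le.mp hle).le

/-- A solution of the relaxed primal problem yields a point of `D̂` with the complementary slack. -/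
theorem exists_slack_eq_of_isMinOn (hd : 2 ≤ d) (hn : n ≠ 0) (hC : C.IsHermitian) (hε : 0 < ε)
    {ρ : MultiMat d n} (hρ : ρ ∈ couplingInt R)
    (hmin : IsMinOn (objective C ε) (couplingInt R) ρ) :
    ∃ X ∈ domainHat C, slack C X = ε • ρ⁻¹ := by
  have hinv := posDef_smul hρ.2.inv hε
  obtain ⟨X, hX, hmarg⟩ := exists_liftSum_marginal_eq hd hn (hC.sub hinv.1)
  -- `H` has zero marginals, so it is an admissible direction and is trace-orthogonal to `liftSum
  -- X`. Hence `tr H*H = -tr CH + ε tr ρ⁻¹H`, which optimality along `H` makes nonpositive, so `H =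
  -- 0`.
  set H : MultiMat d n := liftSum X - (C - ε • ρ⁻¹) with hH
  have hHerm : H.IsHermitian := by
    refine Matrix.IsHermitian.sub ?_ (hC.sub hinv.1)
    rw [Matrix.IsHermitian, liftSum_conjTranspose]
    exact congrArg _ (funext fun j => (hX j).eq)
  have hHmarg : ∀ j, marginal j H = 0 := fun j => by
    rw [hH, ← marginalₗ_apply, map_sub, marginalₗ_apply, marginalₗ_apply, hmarg j, sub_self]
  have hopt := inv_trace_le_of_line_minimizer (C := C) hρ.2 hHerm hε fun t ht => by
    refine hmin (show ρ + t • H ∈ couplingInt R from ⟨⟨ht.posSemidef, fun j => ?_⟩, ht⟩)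
    rw [← marginalₗ_apply, map_add, LinearMap.map_smul_of_tower, marginalₗ_apply, marginalₗ_apply,
      hHmarg j, smul_zero, add_zero, hρ.1.2 j]
  have hlift : (liftSum X * H).trace = 0 := by
    rw [trace_liftSum_mul]
    simp [hHmarg]
  have hHH : (H.conjTranspose * H).trace = -(C * H).trace + ε • (ρ⁻¹ * H).trace := by
    rw [hHerm.eq]
    nth_rewrite 1 [hH]
    rw [Matrix.sub_mul, Matrix.sub_mul, Matrix.trace_sub, Matrix.trace_sub, hlift, Matrix.smul_mul,
      Matrix.trace_smul]
    ring
  have hnonneg := Complex.nonneg_iff.mp (Matrix.posSemidef_conjTranspose_mul_self H).trace_nonneg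
  have hzero : (H.conjTranspose * H).trace = 0 := by
    apply Complex.ext
    · refine le_antisymm ?_ hnonneg.1
      rw [hHH, Complex.add_re, Complex.neg_re, Complex.smul_re, smul_eq_mul, Complex.zero_re]
      linarith
    · exact hnonneg.2.symm
  have hH0 : H = 0 := Matrix.trace_conjTranspose_mul_self_eq_zero_iff.mp hzero
  have hslack : slack C X = ε • ρ⁻¹ := by
    rw [slack_eq, sub_eq_zero.mp (hH.symm.trans hH0), sub_sub_cancel]
  exact ⟨X, ⟨hX, hslack ▸ hinv⟩, hslack⟩

end Duality

end QOT

/-! ### Assembly from one pair with zero duality gap. -/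

theorem theorem5p2 (d n : ℕ) (hd : 2 ≤ d) (hn : 2 ≤ n)
    (R : Fin d → QOT.Mat n) (hR : R ∈ QOT.balanced d n)
    (C : QOT.MultiMat d n) (hC : C.IsHermitian) (ε : ℝ) (hε : 0 < ε) :
    ConcaveOn ℝ (QOT.domainHat C) (QOT.dual C R ε) ∧
    StrictConcaveOn ℝ (QOT.domain C) (QOT.dual C R ε) ∧
    -- the infimum defining `κ_β` is a minimum, and both dual maxima exist and equal it
    IsLeast (QOT.objective C ε '' QOT.couplingInt R) (QOT.kappaBeta C R ε) ∧
    IsGreatest (QOT.dual C R ε '' QOT.domainHat C) (QOT.kappaBeta C R ε) ∧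
    IsGreatest (QOT.dual C R ε '' QOT.domain C) (QOT.kappaBeta C R ε) ∧
    ∃ U : Fin d → QOT.Mat n,
      -- the set of maximizers over `D̂` is exactly `L`, which meets `D` exactly in `U`
      {X | X ∈ QOT.domainHat C ∧ IsMaxOn (QOT.dual C R ε) (QOT.domainHat C) X}
        = QOT.shifts U ∧
      QOT.shifts U ∩ QOT.domain C = {U} ∧
      -- `ε C(X)⁻¹`, for any `X` in `L`, is the unique minimizer of the primal problem
      ∀ X ∈ QOT.shifts U,
        {ρ | ρ ∈ QOT.couplingInt R ∧ IsMinOn (QOT.objective C ε) (QOT.couplingInt R) ρ}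
          = {ε • (QOT.slack C X)⁻¹} := by
  have hd0 : d ≠ 0 := by omega
  have hn0 : n ≠ 0 := by omega
  obtain ⟨ρ, hρ, hmin⟩ := QOT.exists_isMinOn_objective hd0 hn0 hR C hε
  obtain ⟨X₀, hX₀, hslack⟩ := QOT.exists_slack_eq_of_isMinOn hd hn0 hC hε hρ hmin
  obtain ⟨U, hUX, hUtr⟩ := QOT.exists_mem_shifts_trace_eq hn0 hX₀.1
  have hUslack : QOT.slack C U = ε • ρ⁻¹ := by rw [QOT.slack_eq_of_mem_shifts hUX, hslack]
  have hU : U ∈ QOT.domainHat C := ⟨QOT.isHermitian_of_mem_shifts hX₀.1 hUX, by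
    rw [QOT.slack_eq_of_mem_shifts hUX]; exact hX₀.2⟩
  have hUD : U ∈ QOT.domain C := ⟨hU, hUtr⟩
  have hρU : ρ = ε • (QOT.slack C U)⁻¹ := by
    rw [← inv_smul_eq_iff₀ hε.ne']
    refine (Matrix.inv_eq_left_inv ?_).symm
    rw [hUslack, Matrix.smul_mul, Matrix.mul_smul, smul_smul, inv_mul_cancel₀ hε.ne', one_smul,
      Matrix.mul_nonsing_inv _ ((Matrix.isUnit_iff_isUnit_det _).mp hρ.2.isUnit)]
  have hdual : QOT.dual C R ε U = QOT.objective C ε ρ :=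
    (QOT.dual_eq_objective_iff hε hρ hU).mpr hρU
  have hleast : IsLeast (QOT.objective C ε '' QOT.couplingInt R) (QOT.objective C ε ρ) :=
    ⟨⟨ρ, hρ, rfl⟩, by rintro _ ⟨σ, hσ, rfl⟩; exact hmin hσ⟩
  have hkappa : QOT.kappaBeta C R ε = QOT.objective C ε ρ := hleast.csInf_eq
  have hUmem : ∀ {X}, X ∈ QOT.shifts U → X ∈ QOT.domainHat C := fun {X} hX =>
    ⟨QOT.isHermitian_of_mem_shifts hU.1 hX, by
      rw [QOT.slack_eq_of_mem_shifts hX]; exact hU.2⟩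
  refine ⟨QOT.concaveOn_dual C R hε, QOT.strictConcaveOn_dual hn0 C R hε, ?_, ?_, ?_, U, ?_, ?_, ?_⟩
  · rw [hkappa]
    exact hleast
  · rw [hkappa]
    refine ⟨⟨U, hU, hdual⟩, ?_⟩
    rintro _ ⟨X, hX, rfl⟩
    exact QOT.dual_le_objective hε hρ hX
  · rw [hkappa]
    refine ⟨⟨U, hUD, hdual⟩, ?_⟩
    rintro _ ⟨X, hX, rfl⟩
    exact QOT.dual_le_objective hε hρ hX.1
  · ext X
    refine ⟨fun ⟨hX, hmax⟩ => ?_, fun hX => ⟨hUmem hX, fun Y hY => ?_⟩⟩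
    · have heq : QOT.dual C R ε X = QOT.objective C ε ρ :=
        le_antisymm (QOT.dual_le_objective hε hρ hX) (hdual ▸ hmax hU)
      -- Any maximizer also has zero gap with `ρ`, so its slack is that of `U` and it differs from
      -- `U` by a shift.
      have hinv := ((QOT.dual_eq_objective_iff hε hρ hX).mp heq).symm.trans hρU
      exact QOT.mem_shifts_of_slack_eq hn0 hX.1 hU.1
        (Matrix.inv_inj (smul_right_injective _ hε.ne' hinv)
          ((Matrix.isUnit_iff_isUnit_det _).mp hX.2.isUnit))
    · have heq : QOT.dual C R ε X = QOT.objective C ε ρ :=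
        (QOT.dual_eq_objective_iff hε hρ (hUmem hX)).mpr
          (by rw [QOT.slack_eq_of_mem_shifts hX]; exact hρU)
      exact (QOT.dual_le_objective hε hρ hY).trans_eq heq.symm
  · ext X
    refine ⟨fun ⟨hX, hXD⟩ => QOT.eq_of_mem_shifts_of_trace_eq hn0 hX hXD.2 hUtr, ?_⟩
    rintro rfl
    exact ⟨⟨0, by simp, by simp⟩, hUD⟩
  · intro X hX
    rw [QOT.slack_eq_of_mem_shifts hX, ← hρU]
    ext σ
    refine ⟨fun ⟨hσ, hσmin⟩ => ?_, ?_⟩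
    · have heq : QOT.dual C R ε U = QOT.objective C ε σ :=
        hdual.trans (le_antisymm (hmin hσ) (hσmin hρ))
      exact ((QOT.dual_eq_objective_iff hε hσ hU).mp heq).trans hρU.symm
    · rintro rfl
      exact ⟨hρ, hmin⟩
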